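/- Let $r\ge 0$, $S=\mathbb N^r\setminus\{0\}$, and let $\langle-,-\rangle$ be a skew-symmetric bilinear form $\mathbb Z^r\times\mathbb Z^r\to\mathbb Z$. Let $\mathcal R=\bigoplus_{\gamma\in\mathbb N^r}\mathcal R_\gamma$ be a graded associative unital $\mathbb Q$-algebra such that, for $\gamma,\gamma'\in S$, $\langle\gamma,\gamma'\rangle=0$ implies $[\mathcal R_\gamma,\mathcal R_{\gamma'}]=0$. Let $A:S\to\mathcal R$ be a map with $A(\gamma)\in\mathcal R_\gamma$ for all $\gamma\in S$. A function $F:\bigcup_{n\ge1}S^n\to\mathbb Q$ (a collection) acts on a map $H:S\to\mathcal R$ by $$(F*H)(\gamma)=\sum_{n\ge1}\ \sum_{\alpha\in S^n,\ \alpha_1+\dots+\alpha_n=\gamma}F(\alpha)\,H(\alpha_1)\cdots H(\alpha_n),\qquad\gamma\in S.$$ For $\theta\in\mathbb R^r$ and $a\in S$ put $\mu_\theta(a)=\sum_k\theta_ka_k\big/\sum_ka_k$. The stacky invariants $A_\theta:S\to\mathcal R$ are defined recursively by $$A(\gamma)=\sum_{\alpha_1+\dots+\alpha_n=\gamma,\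 \mu_\theta(\alpha_1)>\dots>\mu_\theta(\alpha_n)}A_\theta(\alpha_1)\cdots A_\theta(\alpha_n),\qquad\gamma\in S,$$ and the rational invariants are $\bar A_\theta=\mathbf{log}_\theta*A_\theta$, where, for $\alpha\in S^n$, $\mathbf{log}_\theta(\alpha)=\frac{(-1)^{n-1}}n$ if $\mu_\theta(\alpha_1)=\dots=\mu_\theta(\alpha_n)$ and $\mathbf{log}_\theta(\alpha)=0$ otherwise. The parameter $\theta$ is called generic if, for all $a,b\in S$, $\mu_\theta(a)=\mu_\theta(b)$ implies $ma=nb$ for some integers $m,n\ge1$. For $\gamma\in S$, the rational attractor invariant $\bar A_*(\gamma)$ is the value $\bar A_{\theta'}(\gamma)$ for a generic perturbation $\theta'$ of $\langle-,\gamma\rangle\in\operatorname{Hom}(\mathbb Z^r,\mathbb R)\cong\mathbb R^r$, that is, for any generic $\theta'$ sufficiently close (depending on $\gamma$) to $\langle-,\gamma\rangle$. The attractor collection $g_*$ is defined, for $\alpha\in S^n$, with $\alpha_{\le k}=\alpha_1+\dots+\alpha_k$ and $\alpha_{>k}=\alpha_{k+1}+\dots+\alpha_n$, by $$g_*(\alpha)=\begin{cases}\dfrac{(-1)^{n-1}}{n_0+1}&\text{if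 }\langle\alpha_{\le k},\alpha_{>k}\rangle\ge0\text{ for all }1\le k<n,\\[1ex]0&\text{otherwise,}\end{cases}$$ where $n_0$ is the number of $1\le k<n$ with $\langle\alpha_{\le k},\alpha_{>k}\rangle=0$. Theorem. For every $\gamma\in S$, there are generic $\theta'$ arbitrarily close to $\langle-,\gamma\rangle$, and $\bar A_{\theta'}(\gamma)$ is the same for all generic $\theta'$ close enough to $\langle-,\gamma\rangle$, so that $\bar A_*$ is well defined; and $$\bar A_*=g_**A.$$ -/

import Mathlib

open Filter Topology

namespace AttractorDT

/-- The semigroup `S = ℕ^r \ {0}`. -/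
abbrev S (r : ℕ) : Type := {γ : Fin r → ℕ // γ ≠ 0}

/-- The total degree `δ · γ = γ_1 + ... + γ_r`. -/
def size {r : ℕ} (γ : Fin r → ℕ) : ℕ := ∑ i, γ i

/-- The sum `|α| = α_1 + ... + α_n` of a tuple of elements of `S`, as an element of `ℕ^r`. -/
def total {r : ℕ} (α : List (S r)) : Fin r → ℕ := (α.map Subtype.val).sum

theorem size_add {r : ℕ} (a b : Fin r → ℕ) : size (a + b) = size a + size b := by
  simp [size, Finset.sum_add_distrib]

theorem size_pos {r : ℕ} (a : S r) : 0 < size a.1 := by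
  rcases Nat.eq_zero_or_pos (size a.1) with h | h
  · exfalso
    apply a.2
    funext i
    simpa using (Finset.sum_eq_zero_iff.mp h) i (Finset.mem_univ i)
  · exact h

theorem total_cons {r : ℕ} (a : S r) (α : List (S r)) : total (a :: α) = a.1 + total α := by
  simp [total]

/-- Every element of `ℕ^r` is a sum of elements of `S` in finitely many ways only. -/
theorem finite_tuples {r : ℕ} (γ : Fin r → ℕ) : {α : List (S r) | total α = γ}.Finite := by
  induction h : size γ using Nat.strong_induction_on generalizing γ with
  | _ N ih =>
    have key : {α : List (S r) | total α = γ} ⊆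
        {[]} ∪ ⋃ a ∈ {a : S r | a.1 ≤ γ}, (List.cons a) '' {α | total α = γ - a.1} := by
      intro α hα
      cases α with
      | nil => simp
      | cons a β =>
        right
        have e : a.1 + total β = γ := by rw [← total_cons]; exact hα
        simp only [Set.mem_iUnion]
        refine ⟨a, ?_, β, ?_, rfl⟩
        · change a.1 ≤ γ
          rw [← e]; exact le_self_add
        · change total β = γ - a.1
          rw [← e]; simp
    refine Set.Finite.subset (Set.Finite.union (Set.finite_singleton _)
      (Set.Finite.biUnion ?_ ?_)) key
    · exact Set.Finite.preimage Subtype.val_injective.injOn (Set.finite_Iic γ)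
    · intro a ha
      refine Set.Finite.image _ (ih (size (γ - a.1)) ?_ _ rfl)
      have h1 : size γ = size (γ - a.1) + size a.1 := by
        rw [← size_add, tsub_add_cancel_of_le (show a.1 ≤ γ from ha)]
      have h2 := size_pos a
      omega

/-- The finite set of all tuples `α ∈ S^n`, `n ≥ 1`, with `|α| = γ`. -/
noncomputable def tuples {r : ℕ} (γ : S r) : Finset (List (S r)) := (finite_tuples γ.1).toFinset

theorem mem_tuples {r : ℕ} {γ : S r} {α : List (S r)} : α ∈ tuples γ ↔ total α = γ.1 := by
  simp [tuples]

/-- A member of a decomposition of `γ` other than the trivial one `(γ)` is smaller than `γ`. -/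
theorem size_lt_of_mem {r : ℕ} {γ x : S r} {α : List (S r)} (hα : α ∈ tuples γ)
    (hne : α ≠ [γ]) (hx : x ∈ α) : size x.1 < size γ.1 := by
  classical
  rw [mem_tuples] at hα
  have hp : (x :: α.erase x).Perm α := (List.perm_cons_erase hx).symm
  have ht : x.1 + total (α.erase x) = γ.1 := by
    rw [← total_cons, ← hα]
    exact (hp.map Subtype.val).sum_eq
  cases hβ : α.erase x with
  | nil =>
    exfalso
    rw [hβ] at hp ht
    have h1 : α = [x] := (List.singleton_perm.mp hp).symm
    have h2 : x = γ := Subtype.ext (by simpa [total] using ht)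
    exact hne (by rw [h1, h2])
  | cons y β =>
    rw [hβ, total_cons] at ht
    have h1 := size_pos y
    rw [← ht, size_add, size_add]
    omega

/-- Rational collections: functions on the tuples of elements of `S`. Only non-empty tuples
matter, as the empty one is not a decomposition of any element of `S`. -/
abbrev Collection (r : ℕ) : Type := List (S r) → ℚ

section Algebra

variable {r : ℕ} {R : Type*} [Ring R] [Algebra ℚ R]

/-- The action of a collection `F` on a `1`-collection `H`:
`(F * H)(γ) = ∑_{|α| = γ} F(α) H(α_1) ⋯ H(α_n)`. -/
noncomputable def act (F : Collection r) (H : S r → R) (γ : S r) : R :=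
  ∑ α ∈ tuples γ, F α • (α.map H).prod

end Algebra

/-- The slope `μ_θ(a) = (∑ θ_k a_k) / (∑ a_k)`; the weak stability `a ≤_θ b` is
`slope θ a ≤ slope θ b`. -/
noncomputable def slope {r : ℕ} (θ : Fin r → ℝ) (a : S r) : ℝ :=
  (∑ k, θ k * (a.1 k : ℝ)) / (∑ k, (a.1 k : ℝ))

open Classical in
/-- The Harder-Narasimhan collection `s_θ`: it is `1` if `α_1 >_θ ⋯ >_θ α_n`, and `0` otherwise. -/
noncomputable def hnCollection {r : ℕ} (θ : Fin r → ℝ) : Collection r := fun α =>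
  if α.IsChain (fun a b => slope θ b < slope θ a) then 1 else 0

open Classical in
/-- The logarithmic collection `log_θ`: it is `(-1)^(n-1) / n` if `α_1 ∼_θ ⋯ ∼_θ α_n`, and `0`
otherwise. -/
noncomputable def logCollection {r : ℕ} (θ : Fin r → ℝ) : Collection r := fun α =>
  if α.IsChain (fun a b => slope θ a = slope θ b) then
    (-1 : ℚ) ^ (α.length - 1) / (α.length : ℚ) else 0

section Invariants

variable {r : ℕ} {R : Type*} [Ring R] [Algebra ℚ R]

/-- The stacky invariants `A_θ`, obtained by solving the basic wall-crossing formula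
`A(γ) = ∑_{|α| = γ, α_1 >_θ ⋯ >_θ α_n} A_θ(α_1) ⋯ A_θ(α_n)` recursively
(see `act_hnCollection_stacky`). -/
noncomputable def stacky (θ : Fin r → ℝ) (A : S r → R) (γ : S r) : R :=
  A γ - ∑ α ∈ ((tuples γ).erase [γ]).attach,
    hnCollection θ α.1 • (α.1.attach.map (fun x => stacky θ A x.1)).prod
termination_by size γ.1
decreasing_by
  exact size_lt_of_mem (Finset.mem_of_mem_erase α.2) (Finset.ne_of_mem_erase α.2) x.2

/-- The basic wall-crossing formula `A = s_θ * A_θ`. -/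
theorem act_hnCollection_stacky (θ : Fin r → ℝ) (A : S r → R) :
    act (hnCollection θ) (stacky θ A) = A := by
  classical
  funext γ
  have hmem : [γ] ∈ tuples γ := by simp [mem_tuples, total]
  have h1 : hnCollection θ [γ] = 1 := by simp [hnCollection]
  rw [act, ← Finset.add_sum_erase _ _ hmem, h1]
  simp only [List.map_cons, List.map_nil, List.prod_singleton, one_smul]
  conv_lhs => enter [1]; rw [stacky]
  rw [← Finset.sum_attach ((tuples γ).erase [γ])]
  simp

/-- The rational invariants `log_θ * A_θ` of the stability `θ`. -/
noncomputable def rational (θ : Fin r → ℝ) (A : S r → R) : S r → R :=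
  act (logCollection θ) (stacky θ A)

end Invariants

/-- Proportional elements: `m a = n b` for some `m, n ≥ 1`. -/
def Proportional {r : ℕ} (a b : S r) : Prop :=
  ∃ m n : ℕ, 1 ≤ m ∧ 1 ≤ n ∧ m • a.1 = n • b.1

/-- The set of generic stability parameters: `a ∼_θ b` only for proportional `a, b ∈ S`. -/
def genericStabilities (r : ℕ) : Set (Fin r → ℝ) :=
  {θ | ∀ a b : S r, slope θ a = slope θ b → Proportional a b}

/-- The inclusion `ℕ^r ⊆ ℤ^r`. -/
def toLattice {r : ℕ} (a : Fin r → ℕ) : Fin r → ℤ := fun i => (a i : ℤ)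

/-- The self-stability `θ = ⟨-, γ⟩`, written in coordinates: `θ_k = ⟨e_k, γ⟩`. -/
def selfStability {r : ℕ} (ω : LinearMap.BilinForm ℤ (Fin r → ℤ)) (γ : S r) : Fin r → ℝ :=
  fun k => ((ω (Pi.single k 1) (toLattice γ.1) : ℤ) : ℝ)

/-- The filter of generic perturbations of the self-stability of `γ`: a property holds along it if
it holds for all generic `θ'` that are close enough to `⟨-, γ⟩`. -/
def attractorFilter {r : ℕ} (ω : LinearMap.BilinForm ℤ (Fin r → ℤ)) (γ : S r) :
    Filter (Fin r → ℝ) :=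
  𝓝[genericStabilities r] (selfStability ω γ)

open Classical in
/-- The rational attractor invariant of `γ`: the common value at `γ` of the rational invariants
of all generic `θ'` close enough to `⟨-, γ⟩` (and `0` if there were no such common value). -/
noncomputable def attractorRational {r : ℕ} {R : Type*} [Ring R] [Algebra ℚ R]
    (ω : LinearMap.BilinForm ℤ (Fin r → ℤ)) (A : S r → R) (γ : S r) : R :=
  if h : ∃ x : R, ∀ᶠ θ' in attractorFilter ω γ, rational θ' A γ = x then h.choose else 0

/-- The number `⟨α_{≤k}, α_{>k}⟩`. -/
def cutPairing {r : ℕ} (ω : LinearMap.BilinForm ℤ (Fin r → ℤ)) (α : List (S r)) (k : ℕ) : ℤ :=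
  ω (toLattice (total (α.take k))) (toLattice (total (α.drop k)))

open Classical in
/-- The attractor collection `g_*`: it is `(-1)^(n-1) / (n_0 + 1)` if `⟨α_{≤k}, α_{>k}⟩ ≥ 0` for
all `1 ≤ k < n`, and `0` otherwise; here `n_0` is the number of `1 ≤ k < n` with
`⟨α_{≤k}, α_{>k}⟩ = 0`. -/
noncomputable def attractorCollection {r : ℕ} (ω : LinearMap.BilinForm ℤ (Fin r → ℤ)) :
    Collection r := fun α =>
  if ∀ k ∈ Finset.Ico 1 α.length, 0 ≤ cutPairing ω α k then
    (-1 : ℚ) ^ (α.length - 1) /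
      (((Finset.Ico 1 α.length).filter (fun k => cutPairing ω α k = 0)).card + 1 : ℚ)
  else 0

end AttractorDT

/-!
The cut collection `c_ψ` of a linear function `ψ` takes the value `(-1)^(n-1) / (n_0 + 1)` at the
tuples with `ψ(α_{≤k}) ≥ 0` for all cuts `k`, where `n_0` of these numbers are zero. As
`1 / (n_0 + 1)` is the integral of `X^(n_0)` over `[0, 1]`, this is the integral of a product over
the cuts, and composing it with the Harder-Narasimhan collection `s_θ` adds `1` to the factor of
every cut at which the slope drops. For `ψ(a) = ∑ (θ_k - μ_θ(γ)) a_k` and tuples of sum `γ` the new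
product vanishes unless all slopes are equal, and then it is `(-X)^(n-1)`. So `c_ψ * s_θ = log_θ`
at `γ`, and hence `Ā_θ(γ) = (c_ψ * A)(γ)`.

For `θ` close to `⟨-, γ⟩` this `ψ` is positive wherever `⟨-, γ⟩` is, on the finitely many `a ≤ γ`.
Moreover `g_*` at tuples of sum `γ` is the cut collection of `⟨-, γ⟩`, so it remains to compare two
cut collections. Up to the sign `(-1)^(n-1)`, the value of `c_ψ` at `α` is the probability of
`ψ(α_{≤0}) = 0` when one of the `ψ(α_{≤k})`, `0 ≤ k < n`, is drawn uniformly among the minimal ones.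
Rotating `α` moves the base point, so these probabilities add up to `1` over the rotations of `α`.
A tuple and its rotation by `k` have nonzero weights for the respective functions only if
`⟨α_{≤k}, γ⟩ = 0`; then the two parts of `A(α_1) ⋯ A(α_n)` commute, so that the rotation does not
change the product. Averaging over rotations therefore turns one sum into the other.
-/

namespace AttractorDT

open Polynomial

section CutProducts

variable {ι K : Type*} [CommSemiring K]

/-- The consecutive entries `α_k`, `α_{k+1}` of a list are related. Entries are numbered from `1`
here, so that `k` also numbers the cut between them. -/
def RelAt (rel : ι → ι → Prop) (α : List ι) (k : ℕ) : Prop :=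
  ∀ a ∈ α[k - 1]?, ∀ b ∈ α[k]?, rel a b

open Classical in
/-- The product over all cuts `1 ≤ k < n` of a list of the weight of `(α_1, ..., α_k)`, increased
by `1` if `α_k` and `α_{k+1}` are related. -/
noncomputable def cutProd (w : List ι → K) (rel : ι → ι → Prop) (α : List ι) : K :=
  ∏ k ∈ Finset.Ico 1 α.length, (w (α.take k) + if RelAt rel α k then 1 else 0)

theorem cutProd_bot (w : List ι → K) (α : List ι) :
    cutProd w ⊥ α = ∏ k ∈ Finset.Ico 1 α.length, w (α.take k) := by
  refine Finset.prod_congr rfl fun k hk => ?_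
  rw [Finset.mem_Ico] at hk
  have h : ¬ RelAt ⊥ α k := fun h =>
    h (α[k - 1]) (List.getElem?_eq_getElem _) (α[k]) (List.getElem?_eq_getElem _)
  rw [if_neg h, add_zero]

theorem isChain_append_singleton {rel : ι → ι → Prop} {α : List ι} {b : ι} :
    (α ++ [b]).IsChain rel ↔ α.IsChain rel ∧ ∀ a ∈ α.getLast?, rel a b := by
  simp [List.isChain_append]

open Classical in
theorem cutProd_append_singleton (w : List ι → K) (rel : ι → ι → Prop) {α : List ι} (hα : α ≠ [])
    (b : ι) : cutProd w rel (α ++ [b]) =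
      cutProd w rel α * (w α + if ∀ a ∈ α.getLast?, rel a b then 1 else 0) := by
  have hlen : 0 < α.length := List.length_pos_iff.mpr hα
  have hrel : RelAt rel (α ++ [b]) α.length ↔ ∀ a ∈ α.getLast?, rel a b := by
    rw [RelAt, List.getElem?_append_left (Nat.sub_lt hlen one_pos), ← List.getLast?_eq_getElem?]
    simp
  rw [cutProd, List.length_append, List.length_singleton, Finset.prod_Ico_succ_top hlen]
  congr 1
  · refine Finset.prod_congr rfl fun k hk => ?_
    rw [Finset.mem_Ico] at hk
    rw [RelAt, RelAt, List.take_append_of_le_length hk.2.le, List.getElem?_append_left hk.2,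
      List.getElem?_append_left (by omega)]
  · simp only [hrel, List.take_left]

open Classical in
/-- The product is expanded along the last cut at which the weight is chosen. -/
theorem cutProd_eq_add_sum (w : List ι → K) (rel : ι → ι → Prop) (α : List ι) :
    cutProd w rel α = (if α.IsChain rel then 1 else 0) + ∑ k ∈ Finset.Ico 1 α.length,
      if (α.drop k).IsChain rel then cutProd w rel (α.take k) * w (α.take k) else 0 := by
  induction α using List.reverseRecOn with
  | nil => simp [cutProd]
  | append_singleton α b ih =>
    rcases eq_or_ne α [] with rfl | hα
    · simp [cutProd]
    have hlast : ∀ k ∈ Finset.Ico 1 α.length,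
        (if ((α ++ [b]).drop k).IsChain rel then
          cutProd w rel ((α ++ [b]).take k) * w ((α ++ [b]).take k) else 0) =
        (if (α.drop k).IsChain rel then cutProd w rel (α.take k) * w (α.take k) else 0) *
          if ∀ a ∈ α.getLast?, rel a b then 1 else 0 := by
      intro k hk
      rw [Finset.mem_Ico] at hk
      simp only [List.drop_append_of_le_length hk.2.le, List.take_append_of_le_length hk.2.le,
        isChain_append_singleton, List.getLast?_drop, if_neg hk.2.not_ge, ite_and, mul_ite,
        mul_one, mul_zero]
      split_ifs <;> rfl
    rw [cutProd_append_singleton w rel hα, List.length_append, List.length_singleton,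
      Finset.sum_Ico_succ_top (List.length_pos_iff.mpr hα), Finset.sum_congr rfl hlast,
      ← Finset.sum_mul, mul_add]
    nth_rw 2 [ih]
    simp only [List.drop_left, List.take_left, isChain_append_singleton, List.isChain_singleton,
      if_true, ite_and]
    split_ifs <;> ring

end CutProducts

section Splitting

variable {r : ℕ}

theorem total_append (α β : List (S r)) : total (α ++ β) = total α + total β := by
  simp [total]

theorem total_append_singleton (α : List (S r)) (b : S r) :
    total (α ++ [b]) = total α + b.1 := by
  simp [total]

theorem total_take_add_total_drop (α : List (S r)) (k : ℕ) :
    total (α.take k) + total (α.drop k) = total α := by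
  rw [← total_append, List.take_append_drop]

theorem total_ne_zero {α : List (S r)} (hα : α ≠ []) : total α ≠ 0 := by
  obtain ⟨a, β, rfl⟩ := List.exists_cons_of_ne_nil hα
  rw [total_cons]
  exact fun h => a.2 (add_eq_zero.mp h).1

theorem ne_nil_of_mem_tuples {γ : S r} {α : List (S r)} (hα : α ∈ tuples γ) : α ≠ [] := by
  rintro rfl
  exact γ.2 (mem_tuples.mp hα).symm

theorem singleton_mem_tuples (γ : S r) : [γ] ∈ tuples γ := by
  simp [mem_tuples, total]

/-- The decompositions of `γ` into an ordered pair of elements of `S`. -/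
noncomputable def pairs (γ : S r) : Finset (S r × S r) :=
  (tuples γ).preimage (fun p => [p.1, p.2])
    (Function.Injective.injOn fun p q h => by simpa [Prod.ext_iff] using h)

theorem mem_pairs {γ : S r} {p : S r × S r} : p ∈ pairs γ ↔ p.1.1 + p.2.1 = γ.1 := by
  rw [pairs, Finset.mem_preimage, mem_tuples]
  simp [total]

theorem size_fst_lt_of_mem_pairs {γ : S r} {p : S r × S r} (hp : p ∈ pairs γ) :
    size p.1.1 < size γ.1 := by
  rw [← mem_pairs.mp hp, size_add]
  exact Nat.lt_add_of_pos_right (size_pos p.2)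

theorem sum_pairs_tuples {M : Type*} [AddCommMonoid M] (γ : S r)
    (φ : List (S r) → List (S r) → M) :
    ∑ p ∈ pairs γ, ∑ α ∈ tuples p.1, ∑ β ∈ tuples p.2, φ α β =
      ∑ α ∈ tuples γ, ∑ k ∈ Finset.Ico 1 α.length, φ (α.take k) (α.drop k) := by
  simp_rw [← Finset.sum_product']
  rw [Finset.sum_sigma', Finset.sum_sigma']
  refine Finset.sum_bij' (fun x _ => ⟨x.2.1 ++ x.2.2, x.2.1.length⟩)
    (fun x hx => ⟨(⟨total (x.1.take x.2), total_ne_zero ?take_ne_nil⟩,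
      ⟨total (x.1.drop x.2), total_ne_zero ?drop_ne_nil⟩), (x.1.take x.2, x.1.drop x.2)⟩)
    ?join_mem ?split_mem ?split_join ?join_split fun _ _ => by simp
  case take_ne_nil | drop_ne_nil =>
    simp only [Finset.mem_sigma, Finset.mem_Ico] at hx
    simp only [← List.length_pos_iff, List.length_take, List.length_drop]
    omega
  case join_mem =>
    rintro ⟨⟨a, b⟩, α, β⟩ hx
    simp only [Finset.mem_sigma, Finset.mem_product, mem_pairs] at hx
    obtain ⟨hab, hα, hβ⟩ := hx
    have hαpos := List.length_pos_iff.mpr (ne_nil_of_mem_tuples hα)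
    have hβpos := List.length_pos_iff.mpr (ne_nil_of_mem_tuples hβ)
    simp only [Finset.mem_sigma, mem_tuples, total_append, Finset.mem_Ico, List.length_append]
    rw [mem_tuples.mp hα, mem_tuples.mp hβ]
    exact ⟨hab, by omega, by omega⟩
  case split_mem =>
    rintro ⟨α, k⟩ hx
    simp only [Finset.mem_sigma, mem_tuples] at hx
    simp [mem_pairs, mem_tuples, total_take_add_total_drop, hx.1]
  case split_join =>
    rintro ⟨⟨a, b⟩, α, β⟩ hx
    simp only [Finset.mem_sigma, Finset.mem_product, mem_tuples] at hx
    simp [hx.2]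
  case join_split =>
    rintro ⟨α, k⟩ hx
    simp only [Finset.mem_sigma, Finset.mem_Ico] at hx
    simp [hx.2.2.le]

end Splitting

section Convolution

variable {r : ℕ} {R : Type*} [Ring R] [Algebra ℚ R]

theorem act_congr {F G : Collection r} (H : S r → R) {γ : S r} (h : ∀ α ∈ tuples γ, F α = G α) :
    act F H γ = act G H γ :=
  Finset.sum_congr rfl fun α hα => by rw [h α hα]

open Classical in
/-- The indicator collection of the tuples whose consecutive entries are related. It generalizes
the Harder-Narasimhan collection, where the relation is descent of the slope. -/
noncomputable def chainCollection (rel : S r → S r → Prop) : Collection r := fun α =>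
  if α.IsChain rel then 1 else 0

theorem act_chainCollection_bot (H : S r → R) : act (chainCollection ⊥) H = H := by
  funext γ
  rw [act, Finset.sum_eq_single_of_mem [γ] (singleton_mem_tuples γ)]
  · simp [chainCollection]
  · rintro (_ | ⟨a, _ | ⟨b, β⟩⟩) hα hne
    · exact absurd rfl (ne_nil_of_mem_tuples hα)
    · exact absurd (by simpa [mem_tuples, total, Subtype.ext_iff] using hα) hne
    · simp [chainCollection]

theorem act_mul_act (F G : Collection r) (H : S r → R) (γ₁ γ₂ : S r) :
    act F H γ₁ * act G H γ₂ =
      ∑ α ∈ tuples γ₁, ∑ β ∈ tuples γ₂, (F α * G β) • ((α ++ β).map H).prod := by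
  simp only [act, Finset.sum_mul_sum, smul_mul_smul_comm, List.map_append, List.prod_append]

variable {K : Type*} [CommSemiring K] [Algebra ℚ K]

theorem act_cutProd_eq_add_sum (L : K →ₗ[ℚ] ℚ) (w : (Fin r → ℕ) → K) (rel : S r → S r → Prop)
    (H : S r → R) (γ : S r) :
    act (fun α => L (cutProd (w ∘ total) rel α)) H γ = L 1 • act (chainCollection rel) H γ +
      ∑ p ∈ pairs γ, act (fun α => L (cutProd (w ∘ total) rel α * w p.1.1)) H p.1 *
        act (chainCollection rel) H p.2 := by
  classical
  have hpairs : ∀ p ∈ pairs γ, act (fun α => L (cutProd (w ∘ total) rel α * w p.1.1)) H p.1 *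
      act (chainCollection rel) H p.2 = ∑ α ∈ tuples p.1, ∑ β ∈ tuples p.2,
        (L (cutProd (w ∘ total) rel α * w (total α)) * chainCollection rel β) •
          ((α ++ β).map H).prod := fun p _ => by
    rw [act_mul_act]
    exact Finset.sum_congr rfl fun α hα => by rw [mem_tuples.mp hα]
  rw [Finset.sum_congr rfl hpairs, sum_pairs_tuples γ fun α β =>
    (L (cutProd (w ∘ total) rel α * w (total α)) * chainCollection rel β) • ((α ++ β).map H).prod,
    act, act, Finset.smul_sum, ← Finset.sum_add_distrib]
  refine Finset.sum_congr rfl fun α _ => ?_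
  simp only [List.take_append_drop, ← Finset.sum_smul, smul_smul, ← add_smul]
  rw [cutProd_eq_add_sum, map_add, map_sum]
  congr 2
  · simp only [chainCollection, apply_ite L, map_zero, mul_ite, mul_one, mul_zero]
  · simp only [chainCollection, apply_ite L, map_zero, mul_ite, mul_one, mul_zero,
      Function.comp_apply]

/-- In the composite tuple every cut is either one of the outer tuple, contributing its weight, or
one inside an inner tuple, contributing the relation of its two neighbours. -/
theorem act_cutProd_act_chainCollection (L : K →ₗ[ℚ] ℚ) (w : (Fin r → ℕ) → K)
    (rel : S r → S r → Prop) (H : S r → R) (γ : S r) :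
    act (fun α => L (cutProd (w ∘ total) ⊥ α)) (act (chainCollection rel) H) γ =
      act (fun α => L (cutProd (w ∘ total) rel α)) H γ := by
  induction hN : size γ.1 using Nat.strong_induction_on generalizing γ L with
  | _ N ih =>
    subst hN
    rw [act_cutProd_eq_add_sum, act_cutProd_eq_add_sum, act_chainCollection_bot]
    congr 1
    refine Finset.sum_congr rfl fun p hp => ?_
    congr 1
    exact ih _ (size_fst_lt_of_mem_pairs hp) (L ∘ₗ LinearMap.mulRight ℚ (w p.1.1)) p.1 rfl

end Convolution

section SignWeight

variable {G : Type*} [Zero G] [LinearOrder G]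

/-- The integral of a polynomial over `[0, 1]`. It produces the denominators of the logarithmic and
of the attractor collection from products over cuts. -/
noncomputable def unitIntegral : ℚ[X] →ₗ[ℚ] ℚ :=
  Polynomial.lsum fun n => (n + 1 : ℚ)⁻¹ • LinearMap.id

theorem unitIntegral_neg_one_pow_mul_X_pow (m n : ℕ) :
    unitIntegral ((-1) ^ m * X ^ n) = (-1) ^ m / (n + 1) := by
  have hX : unitIntegral (X ^ n) = (n + 1 : ℚ)⁻¹ := by
    simp [unitIntegral, X_pow_eq_monomial]
  rcases m.even_or_odd with hm | hm
  · rw [hm.neg_one_pow, hm.neg_one_pow, one_mul, hX, inv_eq_one_div]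
  · rw [hm.neg_one_pow, hm.neg_one_pow, neg_one_mul, map_neg, hX, neg_div, inv_eq_one_div]

/-- The contribution of a cut at which a linear function takes the value `x`: a zero contributes
`-X`, so that the exponent of `X` counts the zeros. -/
noncomputable def signWeight (x : G) : ℚ[X] :=
  if 0 ≤ x then -(if x = 0 then X else 1) else 0

theorem signWeight_zero : signWeight (0 : G) = -X := by
  simp [signWeight]

theorem prod_signWeight (s : Finset ℕ) (f : ℕ → G) :
    ∏ k ∈ s, signWeight (f k) =
      if ∀ k ∈ s, 0 ≤ f k then (-1) ^ s.card * X ^ (s.filter (fun k => f k = 0)).card else 0 := by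
  simp only [signWeight, Finset.prod_ite_zero, Finset.prod_neg, Finset.prod_ite, Finset.prod_const,
    one_pow, mul_one]

end SignWeight

section CutCollection

variable {r : ℕ} {G : Type*} [AddCommMonoid G] [LinearOrder G]

/-- The collection with value `(-1)^(n-1) / (n_0 + 1)` on the tuples satisfying `ψ(α_{≤k}) ≥ 0` for
all `1 ≤ k < n`, where `n_0` is the number of these `k` with `ψ(α_{≤k}) = 0`, and `0` on the
others. -/
noncomputable def cutCollection (ψ : (Fin r → ℕ) →+ G) : Collection r := fun α =>
  if ∀ k ∈ Finset.Ico 1 α.length, 0 ≤ ψ (total (α.take k)) then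
    (-1 : ℚ) ^ (α.length - 1) /
      (((Finset.Ico 1 α.length).filter (fun k => ψ (total (α.take k)) = 0)).card + 1 : ℚ)
  else 0

theorem cutCollection_eq_unitIntegral (ψ : (Fin r → ℕ) →+ G) (α : List (S r)) :
    cutCollection ψ α = unitIntegral (cutProd ((signWeight ∘ ψ) ∘ total) ⊥ α) := by
  simp only [cutProd_bot, Function.comp_apply, prod_signWeight, apply_ite unitIntegral, map_zero,
    unitIntegral_neg_one_pow_mul_X_pow, Nat.card_Ico, cutCollection]

end CutCollection

section Slope

variable {r : ℕ} {θ : Fin r → ℝ} {μ : ℝ}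

/-- The linear function `a ↦ ∑ (θ_k - μ) a_k`, whose sign compares the slope of `a` with `μ`. -/
noncomputable def stabilityHom (θ : Fin r → ℝ) (μ : ℝ) : (Fin r → ℕ) →+ ℝ where
  toFun a := ∑ k, (θ k - μ) * (a k : ℝ)
  map_zero' := by simp
  map_add' a b := by simp [mul_add, Finset.sum_add_distrib]

theorem stabilityHom_apply (a : Fin r → ℕ) :
    stabilityHom θ μ a = ∑ k, (θ k - μ) * (a k : ℝ) := rfl

theorem sum_cast_pos (a : S r) : (0 : ℝ) < ∑ k, (a.1 k : ℝ) := by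
  exact_mod_cast size_pos a

theorem stabilityHom_eq_mul (a : S r) :
    stabilityHom θ μ a.1 = (slope θ a - μ) * ∑ k, (a.1 k : ℝ) := by
  rw [stabilityHom_apply, slope, sub_mul, div_mul_cancel₀ _ (sum_cast_pos a).ne']
  simp only [sub_mul, Finset.sum_sub_distrib, Finset.mul_sum]

theorem stabilityHom_pos_iff {a : S r} : 0 < stabilityHom θ μ a.1 ↔ μ < slope θ a := by
  rw [stabilityHom_eq_mul, mul_pos_iff_of_pos_right (sum_cast_pos a), sub_pos]

theorem stabilityHom_neg_iff {a : S r} : stabilityHom θ μ a.1 < 0 ↔ slope θ a < μ := by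
  rw [stabilityHom_eq_mul, ← neg_pos, ← neg_mul, mul_pos_iff_of_pos_right (sum_cast_pos a),
    neg_sub, sub_pos]

theorem stabilityHom_eq_zero_iff {a : S r} : stabilityHom θ μ a.1 = 0 ↔ slope θ a = μ := by
  rw [stabilityHom_eq_mul, mul_eq_zero, or_iff_left (sum_cast_pos a).ne', sub_eq_zero]

/-- The product over the cuts of a tuple that arises when the cut collection of `stabilityHom θ μ`
is composed with the Harder-Narasimhan collection of `θ`. -/
noncomputable def slopeCutProd (θ : Fin r → ℝ) (μ : ℝ) : List (S r) → ℚ[X] :=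
  cutProd ((signWeight ∘ stabilityHom θ μ) ∘ total) fun a b => slope θ b < slope θ a

open Classical in
theorem slopeCutProd_append_append (α : List (S r)) (a b : S r) :
    slopeCutProd θ μ (α ++ [a] ++ [b]) = slopeCutProd θ μ (α ++ [a]) *
      (signWeight (stabilityHom θ μ (total (α ++ [a]))) +
        if slope θ b < slope θ a then 1 else 0) := by
  rw [slopeCutProd, cutProd_append_singleton _ _ (List.append_ne_nil_of_right_ne_nil _ (by simp))]
  simp

/-- After a positive partial sum the slope cannot drop, since the weight `-1` of the cut would be
cancelled; after a negative one it has to drop. -/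
theorem sign_stabilityHom_total {α : List (S r)} {b : S r} (h : slopeCutProd θ μ (α ++ [b]) ≠ 0) :
    SignType.sign (stabilityHom θ μ (total (α ++ [b]))) =
      SignType.sign (stabilityHom θ μ b.1) := by
  induction α using List.reverseRecOn generalizing b with
  | nil => simp [total]
  | append_singleton α a ih =>
    rw [slopeCutProd_append_append, mul_ne_zero_iff] at h
    obtain ⟨hfactor, hcut⟩ := h
    have hsign := ih hfactor
    rw [total_append_singleton, map_add]
    rcases lt_trichotomy (stabilityHom θ μ a.1) 0 with ha | ha | ha
    · have hsum := sign_eq_neg_one_iff.mp (hsign.trans (sign_neg ha))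
      have hdrop : slope θ b < slope θ a := by
        by_contra hdrop
        simp [signWeight, hsum.not_ge, hdrop] at hcut
      have hb := stabilityHom_neg_iff.mpr (hdrop.trans (stabilityHom_neg_iff.mp ha))
      rw [sign_neg (add_neg hsum hb), sign_neg hb]
    · rw [ha, sign_zero, sign_eq_zero_iff] at hsign
      rw [hsign, zero_add]
    · have hsum := sign_eq_one_iff.mp (hsign.trans (sign_pos ha))
      have hdrop : ¬ slope θ b < slope θ a := fun hdrop => by
        simp [signWeight, hsum.le, hsum.ne', hdrop] at hcut
      have hb := stabilityHom_pos_iff.mpr ((stabilityHom_pos_iff.mp ha).trans_le (not_lt.mp hdrop))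
      rw [sign_pos (add_pos hsum hb), sign_pos hb]

open Classical in
theorem slopeCutProd_of_stabilityHom_total_eq_zero {α : List (S r)}
    (h : stabilityHom θ μ (total α) = 0) : slopeCutProd θ μ α =
      if ∀ a ∈ α, slope θ a = μ then (-1) ^ (α.length - 1) * X ^ (α.length - 1) else 0 := by
  induction α using List.reverseRecOn with
  | nil => simp [slopeCutProd, cutProd]
  | append_singleton α b ih =>
    by_cases hb : slope θ b = μ
    · rcases List.eq_nil_or_concat' α with rfl | ⟨α, a, rfl⟩
      · simp [slopeCutProd, cutProd, hb]
      have hα : stabilityHom θ μ (total (α ++ [a])) = 0 := by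
        rwa [total_append_singleton, map_add, stabilityHom_eq_zero_iff.mpr hb, add_zero] at h
      simp only [slopeCutProd_append_append, ih hα, hα, signWeight_zero]
      have hall : (∀ c ∈ α ++ [a] ++ [b], slope θ c = μ) ↔ ∀ c ∈ α ++ [a], slope θ c = μ := by
        simp only [List.forall_mem_append, List.forall_mem_singleton, hb, and_true]
      by_cases hslope : ∀ c ∈ α ++ [a], slope θ c = μ
      · have ha : slope θ a = μ := hslope a (by simp)
        simp only [if_pos hslope, if_pos (hall.mpr hslope), ha, hb, lt_irrefl, if_false, add_zero,
          List.length_append, List.length_singleton, Nat.add_sub_cancel]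
        ring
      · rw [if_neg hslope, if_neg (mt hall.mp hslope), zero_mul]
    · have hne : stabilityHom θ μ b.1 ≠ 0 := mt stabilityHom_eq_zero_iff.mp hb
      rw [if_neg fun hall => hb (hall b (by simp))]
      by_contra hprod
      have := sign_stabilityHom_total hprod
      rw [h, sign_zero, eq_comm, sign_eq_zero_iff] at this
      exact hne this

theorem isChain_slope_eq_iff {γ : S r} {α : List (S r)} (hα : α ∈ tuples γ) :
    α.IsChain (fun a b => slope θ a = slope θ b) ↔ ∀ a ∈ α, slope θ a = slope θ γ := by
  refine ⟨fun hchain => ?_, fun h => List.isChain_iff_pairwise.mpr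
    (List.pairwise_of_forall_mem_list fun a ha b hb => (h a ha).trans (h b hb).symm)⟩
  obtain ⟨c, β, rfl⟩ := List.exists_cons_of_ne_nil (ne_nil_of_mem_tuples hα)
  have hc : ∀ a ∈ c :: β, slope θ a = slope θ c := by
    rw [List.isChain_iff_pairwise, List.pairwise_cons] at hchain
    simpa using fun a ha => (hchain.1 a ha).symm
  have hzero : stabilityHom θ (slope θ c) γ.1 = 0 := by
    rw [← mem_tuples.mp hα, total, map_list_sum]
    refine List.sum_eq_zero ?_
    simpa only [List.forall_mem_map, stabilityHom_eq_zero_iff] using hc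
  rwa [stabilityHom_eq_zero_iff.mp hzero]

theorem logCollection_eq_unitIntegral {γ : S r} {α : List (S r)} (hα : α ∈ tuples γ) :
    logCollection θ α = unitIntegral (slopeCutProd θ (slope θ γ) α) := by
  have hzero : stabilityHom θ (slope θ γ) (total α) = 0 := by
    rw [mem_tuples.mp hα, stabilityHom_eq_zero_iff]
  have hlen : ((α.length - 1 : ℕ) : ℚ) + 1 = α.length := by
    exact_mod_cast Nat.sub_add_cancel (List.length_pos_iff.mpr (ne_nil_of_mem_tuples hα))
  simp only [slopeCutProd_of_stabilityHom_total_eq_zero hzero, apply_ite unitIntegral, map_zero,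
    unitIntegral_neg_one_pow_mul_X_pow, hlen, logCollection, isChain_slope_eq_iff hα]

theorem rational_eq_act_cutCollection {R : Type*} [Ring R] [Algebra ℚ R] (θ : Fin r → ℝ)
    (A : S r → R) (γ : S r) :
    rational θ A γ = act (cutCollection (stabilityHom θ (slope θ γ))) A γ := by
  let ψ := stabilityHom θ (slope θ γ)
  calc rational θ A γ = act (unitIntegral ∘ slopeCutProd θ (slope θ γ)) (stacky θ A) γ :=
        act_congr _ fun α hα => logCollection_eq_unitIntegral hα
    _ = act (fun α => unitIntegral (cutProd ((signWeight ∘ ψ) ∘ total) ⊥ α))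
          (act (hnCollection θ) (stacky θ A)) γ :=
        (act_cutProd_act_chainCollection unitIntegral _ _ _ γ).symm
    _ = act (cutCollection ψ) A γ := by
        rw [act_hnCollection_stacky]
        exact act_congr A fun α _ => (cutCollection_eq_unitIntegral ψ α).symm

end Slope

section MinWeight

variable {G : Type*} [LinearOrder G]

/-- The weights of a uniformly random choice among the minima of `M`: it is `1 / m` if `y` is the
minimum of `M` and has multiplicity `m`, and `0` otherwise. -/
noncomputable def minWeight (M : Multiset G) (y : G) : ℚ :=
  if ∀ x ∈ M, y ≤ x then 1 / (M.count y : ℚ) else 0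

theorem sum_map_minWeight {M : Multiset G} (hM : M ≠ 0) : (M.map (minWeight M)).sum = 1 := by
  obtain ⟨m, hm, hmin⟩ : ∃ m ∈ M, ∀ x ∈ M, m ≤ x := by
    obtain ⟨m, hm, hmin⟩ := M.toFinset.exists_min_image id (Multiset.toFinset_nonempty.mpr hM)
    exact ⟨m, Multiset.mem_toFinset.mp hm, fun x hx => hmin x (Multiset.mem_toFinset.mpr hx)⟩
  have hweight : ∀ y ∈ M, minWeight M y = if y = m then 1 / (M.count m : ℚ) else 0 := by
    intro y hy
    rcases eq_or_ne y m with rfl | hne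
    · rw [minWeight, if_pos hmin, if_pos rfl]
    · rw [minWeight, if_neg fun h => hne (le_antisymm (h m hm) (hmin y hy)), if_neg hne]
  have hcount : (M.count m : ℚ) ≠ 0 := Nat.cast_ne_zero.mpr (Multiset.count_pos.mpr hm).ne'
  rw [Multiset.map_congr rfl hweight, Finset.sum_multiset_map_count]
  simp [hm, hcount]

theorem minWeight_map {H : Type*} [LinearOrder H] {f : G → H} (hf : StrictMono f) (M : Multiset G)
    (y : G) : minWeight (M.map f) (f y) = minWeight M y := by
  simp only [minWeight, Multiset.count_map_eq_count' f M hf.injective, Multiset.mem_map,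
    forall_exists_index, and_imp, forall_apply_eq_imp_iff₂, hf.le_iff_le]

end MinWeight

section Rotation

variable {r : ℕ}

theorem total_rotate (α : List (S r)) (k : ℕ) : total (α.rotate k) = total α :=
  ((α.rotate_perm k).map Subtype.val).sum_eq

theorem sum_tuples_rotate {M : Type*} [AddCommMonoid M] (γ : S r)
    (f : List (S r) → List (S r) → M) :
    ∑ α ∈ tuples γ, ∑ k ∈ Finset.range α.length, f α (α.rotate k) =
      ∑ α ∈ tuples γ, ∑ k ∈ Finset.range α.length, f (α.rotate k) α := by
  have hback : ∀ {α : List (S r)} {k : ℕ}, k < α.length →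
      (α.rotate k).rotate ((α.length - k) % α.length) = α := fun {α k} hk => by
    rw [← List.length_rotate α k, List.rotate_mod, List.rotate_rotate, List.length_rotate,
      Nat.add_sub_cancel' hk.le, List.rotate_length]
  have hindex : ∀ {n k : ℕ}, k < n → (n - (n - k) % n) % n = k := fun {n k} hk => by
    rcases k.eq_zero_or_pos with rfl | hpos
    · simp
    · rw [Nat.mod_eq_of_lt (Nat.sub_lt (hpos.trans hk) hpos), Nat.sub_sub_self hk.le,
        Nat.mod_eq_of_lt hk]
  rw [Finset.sum_sigma', Finset.sum_sigma']
  let e : (_ : List (S r)) × ℕ → (_ : List (S r)) × ℕ := fun x =>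
    ⟨x.1.rotate x.2, (x.1.length - x.2) % x.1.length⟩
  refine Finset.sum_nbij' e e ?_ ?_ ?_ ?_ ?_
  all_goals
    rintro ⟨α, k⟩ hx
    simp only [Finset.mem_sigma, Finset.mem_range, mem_tuples] at hx
    have hlen : 0 < α.length := k.zero_le.trans_lt hx.2
    simp [e, mem_tuples, total_rotate, hback hx.2, hindex hx.2, hx.1, Nat.mod_lt _ hlen]

end Rotation

section PartialSums

variable {r : ℕ}

section Monoid

variable {G : Type*} [AddCommMonoid G]

/-- The multiset of the values of `ψ` on `α_{≤k}` for `0 ≤ k < n`. -/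
noncomputable def partialSums (ψ : (Fin r → ℕ) →+ G) (α : List (S r)) : Multiset G :=
  (Multiset.range α.length).map fun k => ψ (total (α.take k))

theorem partialSums_append (ψ : (Fin r → ℕ) →+ G) (α β : List (S r)) :
    partialSums ψ (α ++ β) = partialSums ψ α + (partialSums ψ β).map (ψ (total α) + ·) := by
  rw [partialSums, List.length_append, Multiset.range_add, Multiset.map_add, Multiset.map_map,
    partialSums, partialSums, Multiset.map_map]
  congr 1
  · refine Multiset.map_congr rfl fun k hk => ?_
    rw [List.take_append_of_le_length (Multiset.mem_range.mp hk).le]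
  · refine Multiset.map_congr rfl fun k _ => ?_
    simp [List.take_append, total_append, List.take_of_length_le]

variable [LinearOrder G]

theorem cutCollection_eq_minWeight (ψ : (Fin r → ℕ) →+ G) {α : List (S r)} (hα : α ≠ []) :
    cutCollection ψ α = minWeight (partialSums ψ α) 0 * (-1) ^ (α.length - 1) := by
  have hlen := List.length_pos_iff.mpr hα
  have hnonneg : (∀ x ∈ partialSums ψ α, 0 ≤ x) ↔
      ∀ k ∈ Finset.Ico 1 α.length, 0 ≤ ψ (total (α.take k)) := by
    simp only [partialSums, Multiset.mem_map, ← Finset.range_val, Finset.mem_val,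
      forall_exists_index, and_imp, forall_apply_eq_imp_iff₂, Finset.range_eq_Ico]
    rw [← Finset.insert_Ico_add_one_left_eq_Ico hlen, Finset.forall_mem_insert]
    simp [total]
  have hcount : (partialSums ψ α).count 0 =
      ((Finset.Ico 1 α.length).filter (fun k => ψ (total (α.take k)) = 0)).card + 1 := by
    have hrange : (partialSums ψ α).count 0 =
        ((Finset.range α.length).filter (fun k => ψ (total (α.take k)) = 0)).card := by
      simp only [partialSums, Multiset.count_map, eq_comm (a := (0 : G))]
      rfl
    rw [hrange, Finset.range_eq_Ico, ← Finset.insert_Ico_add_one_left_eq_Ico hlen,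
      Finset.filter_insert]
    simp [total]
  simp only [cutCollection, minWeight, hnonneg, hcount, ite_mul, zero_mul, Nat.cast_add_one,
    one_div_mul_eq_div]

theorem nonneg_of_minWeight_partialSums_ne_zero {ψ : (Fin r → ℕ) →+ G} {α : List (S r)}
    (h : ψ (total α) = 0) (hweight : minWeight (partialSums ψ α) 0 ≠ 0) (k : ℕ) :
    0 ≤ ψ (total (α.take k)) := by
  rcases lt_or_ge k α.length with hk | hk
  · exact (ite_ne_right_iff.mp hweight).1 _
      (Multiset.mem_map_of_mem (fun k => ψ (total (α.take k))) (Multiset.mem_range.mpr hk))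
  · rw [List.take_of_length_le hk, h]

theorem act_cutCollection_eq_sum {R : Type*} [Ring R] [Algebra ℚ R] (ψ : (Fin r → ℕ) →+ G)
    (H : S r → R) (γ : S r) : act (cutCollection ψ) H γ =
      ∑ α ∈ tuples γ, minWeight (partialSums ψ α) 0 • (-1 : ℚ) ^ (α.length - 1) • (α.map H).prod :=
  Finset.sum_congr rfl fun α hα => by
    rw [cutCollection_eq_minWeight ψ (ne_nil_of_mem_tuples hα), mul_smul]

end Monoid

section Group

variable {G : Type*} [AddCommGroup G]

theorem partialSums_rotate {ψ : (Fin r → ℕ) →+ G} {α : List (S r)} (h : ψ (total α) = 0) {k : ℕ}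
    (hk : k ≤ α.length) : partialSums ψ (α.rotate k) =
      (partialSums ψ α).map (· - ψ (total (α.take k))) := by
  have hdrop : ψ (total (α.drop k)) = -ψ (total (α.take k)) := by
    rw [eq_neg_iff_add_eq_zero, ← map_add, add_comm, total_take_add_total_drop, h]
  conv_rhs => rw [← List.take_append_drop k α]
  rw [List.rotate_eq_drop_append_take hk, partialSums_append, partialSums_append, Multiset.map_add,
    Multiset.map_map, hdrop, add_comm]
  congr 1
  · refine Multiset.map_congr rfl fun x _ => ?_
    simp [sub_eq_neg_add]
  · simp

variable [LinearOrder G] [IsOrderedAddMonoid G]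

theorem sum_minWeight_partialSums_rotate {ψ : (Fin r → ℕ) →+ G} {α : List (S r)} (hα : α ≠ [])
    (h : ψ (total α) = 0) :
    ∑ k ∈ Finset.range α.length, minWeight (partialSums ψ (α.rotate k)) 0 = 1 := by
  have hne : partialSums ψ α ≠ 0 := by
    rw [partialSums, ← Multiset.card_pos, Multiset.card_map, Multiset.card_range]
    exact List.length_pos_iff.mpr hα
  calc ∑ k ∈ Finset.range α.length, minWeight (partialSums ψ (α.rotate k)) 0
      = ∑ k ∈ Finset.range α.length, minWeight (partialSums ψ α) (ψ (total (α.take k))) := by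
        refine Finset.sum_congr rfl fun k hk => ?_
        rw [partialSums_rotate h (Finset.mem_range.mp hk).le, ← sub_self (ψ (total (α.take k))),
          minWeight_map fun _ _ h => sub_lt_sub_right h _]
    _ = ((partialSums ψ α).map (minWeight (partialSums ψ α))).sum := by
        conv_rhs => enter [1, 2]; rw [partialSums]
        rw [Multiset.map_map]
        rfl
    _ = 1 := sum_map_minWeight hne

end Group

end PartialSums

section Comparison

variable {r : ℕ} {G G' : Type*} [AddCommGroup G] [LinearOrder G]
  [AddCommGroup G'] [LinearOrder G'] [IsOrderedAddMonoid G']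

/-- The two weights can both be nonzero only for a rotation through an element of the kernel of
`ψ`. -/
theorem map_total_take_eq_zero {ψ : (Fin r → ℕ) →+ G} {ψ' : (Fin r → ℕ) →+ G'} {α : List (S r)}
    (h : ψ (total α) = 0) (h' : ψ' (total α) = 0) (hpos : ∀ a ≤ total α, 0 < ψ a → 0 < ψ' a)
    {k : ℕ} (hk : k ≤ α.length) (hα : minWeight (partialSums ψ' α) 0 ≠ 0)
    (hrot : minWeight (partialSums ψ (α.rotate k)) 0 ≠ 0) : ψ (total (α.take k)) = 0 := by
  have hsplit := total_take_add_total_drop α k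
  have hdrop : 0 ≤ ψ (total (α.drop k)) := by
    have := nonneg_of_minWeight_partialSums_ne_zero (by rwa [total_rotate]) hrot (α.length - k)
    rwa [List.rotate_eq_drop_append_take hk, ← List.length_drop, List.take_left] at this
  have htake : 0 ≤ ψ' (total (α.take k)) := nonneg_of_minWeight_partialSums_ne_zero h' hα k
  have hdrop' : ψ' (total (α.drop k)) ≤ 0 := by
    rw [← hsplit, map_add, add_eq_zero_iff_neg_eq] at h'
    rwa [← h', neg_nonpos]
  have hdrop_eq : ψ (total (α.drop k)) = 0 :=
    hdrop.eq_of_not_lt' fun hlt =>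
      (hpos _ (hsplit ▸ le_add_self) hlt).not_ge hdrop'
  rwa [← hsplit, map_add, hdrop_eq, add_zero] at h

variable [IsOrderedAddMonoid G]

/-- Expanding one factor `1` as the sum of the weights of all rotations makes both sides sums over
the same pairs of a tuple and its rotation. -/
theorem sum_minWeight_smul_eq {M : Type*} [AddCommMonoid M] [Module ℚ M]
    {ψ : (Fin r → ℕ) →+ G} {ψ' : (Fin r → ℕ) →+ G'} {γ : S r} (h : ψ γ.1 = 0) (h' : ψ' γ.1 = 0)
    (hpos : ∀ a ≤ γ.1, 0 < ψ a → 0 < ψ' a) {B : List (S r) → M}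
    (hB : ∀ α ∈ tuples γ, ∀ k ≤ α.length, ψ (total (α.take k)) = 0 → B (α.rotate k) = B α) :
    ∑ α ∈ tuples γ, minWeight (partialSums ψ' α) 0 • B α =
      ∑ α ∈ tuples γ, minWeight (partialSums ψ α) 0 • B α := by
  let p := fun α => minWeight (partialSums ψ α) 0
  let p' := fun α => minWeight (partialSums ψ' α) 0
  have hsum : ∀ α ∈ tuples γ, ∑ k ∈ Finset.range α.length, p (α.rotate k) = 1 := fun α hα =>
    sum_minWeight_partialSums_rotate (ne_nil_of_mem_tuples hα) (by rw [mem_tuples.mp hα, h])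
  have hsum' : ∀ α ∈ tuples γ, ∑ k ∈ Finset.range α.length, p' (α.rotate k) = 1 := fun α hα =>
    sum_minWeight_partialSums_rotate (ne_nil_of_mem_tuples hα) (by rw [mem_tuples.mp hα, h'])
  calc ∑ α ∈ tuples γ, p' α • B α
      = ∑ α ∈ tuples γ, ∑ k ∈ Finset.range α.length, (p (α.rotate k) * p' α) • B α :=
        Finset.sum_congr rfl fun α hα => by
          rw [← Finset.sum_smul, ← Finset.sum_mul, hsum α hα, one_mul]
    _ = ∑ α ∈ tuples γ, ∑ k ∈ Finset.range α.length,
          (p (α.rotate k) * p' α) • B (α.rotate k) := by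
        refine Finset.sum_congr rfl fun α hα => Finset.sum_congr rfl fun k hk => ?_
        by_cases hne : p (α.rotate k) * p' α = 0
        · rw [hne, zero_smul, zero_smul]
        have hk := (Finset.mem_range.mp hk).le
        rw [← mem_tuples.mp hα] at h h' hpos
        rw [hB α hα k hk (map_total_take_eq_zero h h' hpos hk (right_ne_zero_of_mul hne)
          (left_ne_zero_of_mul hne))]
    _ = ∑ α ∈ tuples γ, ∑ k ∈ Finset.range α.length, (p α * p' (α.rotate k)) • B α :=
        (sum_tuples_rotate γ fun α β => (p α * p' β) • B α).symm
    _ = ∑ α ∈ tuples γ, p α • B α :=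
        Finset.sum_congr rfl fun α hα => by
          rw [← Finset.sum_smul, ← Finset.mul_sum, hsum' α hα, mul_one]

theorem act_cutCollection_eq {R : Type*} [Ring R] [Algebra ℚ R] {ψ : (Fin r → ℕ) →+ G}
    {ψ' : (Fin r → ℕ) →+ G'} {γ : S r} (h : ψ γ.1 = 0) (h' : ψ' γ.1 = 0)
    (hpos : ∀ a ≤ γ.1, 0 < ψ a → 0 < ψ' a) {A : S r → R}
    (hA : ∀ α ∈ tuples γ, ∀ k ≤ α.length, ψ (total (α.take k)) = 0 →
      Commute ((α.take k).map A).prod ((α.drop k).map A).prod) :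
    act (cutCollection ψ') A γ = act (cutCollection ψ) A γ := by
  let B := fun α : List (S r) => (-1 : ℚ) ^ (α.length - 1) • (α.map A).prod
  have hB : ∀ α ∈ tuples γ, ∀ k ≤ α.length, ψ (total (α.take k)) = 0 →
      B (α.rotate k) = B α := fun α hα k hk hzero => by
    have hprod : ((α.rotate k).map A).prod = (α.map A).prod := by
      rw [List.rotate_eq_drop_append_take hk, List.map_append, List.prod_append,
        ← (hA α hα k hk hzero).eq, ← List.prod_append, ← List.map_append, List.take_append_drop]
    simp only [B, List.length_rotate, hprod]
  rw [act_cutCollection_eq_sum, act_cutCollection_eq_sum]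
  exact sum_minWeight_smul_eq h h' hpos hB

end Comparison

section Generic

variable {r : ℕ}

/-- The slope of `a` as a linear function of the stability. -/
noncomputable def slopeHom (a : S r) : (Fin r → ℝ) →ₗ[ℝ] ℝ where
  toFun θ := slope θ a
  map_add' θ θ' := by simp [slope, add_mul, Finset.sum_add_distrib, add_div]
  map_smul' c θ := by simp [slope, mul_assoc, ← Finset.mul_sum, mul_div_assoc]

theorem continuous_slope (a : S r) : Continuous fun θ : Fin r → ℝ => slope θ a :=
  (slopeHom a).continuous_of_finiteDimensional

theorem slope_single (k : Fin r) (a : S r) : slope (Pi.single k 1) a = a.1 k / size a.1 := by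
  simp [slope, size, Pi.single_apply]

theorem proportional_of_slopeHom_eq {a b : S r} (h : slopeHom a = slopeHom b) :
    Proportional a b := by
  refine ⟨size b.1, size a.1, size_pos b, size_pos a, funext fun k => ?_⟩
  have hk : slope (Pi.single k 1) a = slope (Pi.single k 1) b :=
    LinearMap.congr_fun h (Pi.single k 1)
  have ha : (size a.1 : ℝ) ≠ 0 := Nat.cast_ne_zero.mpr (size_pos a).ne'
  have hb : (size b.1 : ℝ) ≠ 0 := Nat.cast_ne_zero.mpr (size_pos b).ne'
  rw [slope_single, slope_single, div_eq_div_iff ha hb] at hk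
  simp only [Pi.smul_apply, smul_eq_mul]
  rw [mul_comm, mul_comm (size a.1)]
  exact_mod_cast hk

theorem dense_slope_ne {a b : S r} (h : ¬ Proportional a b) :
    Dense {θ : Fin r → ℝ | slope θ a ≠ slope θ b} := by
  have hcompl : {θ : Fin r → ℝ | slope θ a ≠ slope θ b} =
      (LinearMap.eqLocus (slopeHom a) (slopeHom b) : Set (Fin r → ℝ))ᶜ := rfl
  rw [hcompl, ← interior_eq_empty_iff_dense_compl, ← Set.not_nonempty_iff_eq_empty]
  intro hne
  have htop := Submodule.eq_top_of_nonempty_interior' _ hne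
  exact h (proportional_of_slopeHom_eq (LinearMap.eqLocus_eq_top.mp htop))

theorem dense_genericStabilities (r : ℕ) : Dense (genericStabilities r) := by
  have hinter : genericStabilities r = ⋂ p ∈ {p : S r × S r | ¬ Proportional p.1 p.2},
      {θ : Fin r → ℝ | slope θ p.1 ≠ slope θ p.2} := by
    ext θ
    simp only [genericStabilities, Set.mem_ofPred_eq, Set.mem_iInter, Prod.forall]
    exact forall₂_congr fun a b => not_imp_not.symm
  rw [hinter]
  exact dense_biInter_of_isOpen
    (fun p _ => isOpen_ne_fun (continuous_slope p.1) (continuous_slope p.2)) (Set.to_countable _)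
    fun p hp => dense_slope_ne hp

end Generic

section Attractor

variable {r : ℕ} {ω : LinearMap.BilinForm ℤ (Fin r → ℤ)}

theorem neBot_attractorFilter (ω : LinearMap.BilinForm ℤ (Fin r → ℤ)) (γ : S r) :
    (attractorFilter ω γ).NeBot :=
  mem_closure_iff_nhdsWithin_neBot.mp (dense_genericStabilities r _)

/-- The linear function `⟨-, γ⟩` on `ℕ^r`. -/
def pairingHom (ω : LinearMap.BilinForm ℤ (Fin r → ℤ)) (γ : Fin r → ℕ) : (Fin r → ℕ) →+ ℤ where
  toFun a := ω (toLattice a) (toLattice γ)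
  map_zero' := by rw [show toLattice (0 : Fin r → ℕ) = 0 from rfl, map_zero, LinearMap.zero_apply]
  map_add' a b := by
    rw [show toLattice (a + b) = toLattice a + toLattice b from
      funext fun i => Nat.cast_add (a i) (b i), map_add, LinearMap.add_apply]

theorem pairingHom_apply (γ a : Fin r → ℕ) :
    pairingHom ω γ a = ω (toLattice a) (toLattice γ) := rfl

theorem stabilityHom_selfStability (γ : S r) (a : Fin r → ℕ) :
    stabilityHom (selfStability ω γ) 0 a = pairingHom ω γ.1 a := by
  have hsum : toLattice a = ∑ k, (a k : ℤ) • (Pi.single k 1 : Fin r → ℤ) := by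
    funext i
    simp [toLattice, Finset.sum_apply, Pi.single_apply]
  rw [pairingHom_apply, hsum, map_sum, LinearMap.sum_apply, stabilityHom_apply, Int.cast_sum]
  refine Finset.sum_congr rfl fun k _ => ?_
  rw [map_smul, LinearMap.smul_apply, selfStability, sub_zero, smul_eq_mul, Int.cast_mul,
    Int.cast_natCast, mul_comm]

theorem form_self_eq_zero (hω : ∀ a b, ω a b = -ω b a) (a : Fin r → ℤ) : ω a a = 0 :=
  self_eq_neg.mp (hω a a)

theorem pairingHom_eq_cutPairing (hω : ∀ a b, ω a b = -ω b a) {γ : S r} {α : List (S r)}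
    (hα : α ∈ tuples γ) (k : ℕ) : pairingHom ω γ.1 (total (α.take k)) = cutPairing ω α k := by
  rw [pairingHom_apply, hω, ← pairingHom_apply, ← mem_tuples.mp hα, ← total_take_add_total_drop α k,
    map_add, pairingHom_apply, form_self_eq_zero hω, zero_add, pairingHom_apply, ← hω, cutPairing]

theorem attractorCollection_eq_cutCollection (hω : ∀ a b, ω a b = -ω b a) {γ : S r}
    {α : List (S r)} (hα : α ∈ tuples γ) :
    attractorCollection ω α = cutCollection (pairingHom ω γ.1) α := by
  simp only [attractorCollection, cutCollection, pairingHom_eq_cutPairing hω hα]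
  congr

theorem slope_selfStability (hω : ∀ a b, ω a b = -ω b a) (γ : S r) :
    slope (selfStability ω γ) γ = 0 := by
  rw [← stabilityHom_eq_zero_iff, stabilityHom_selfStability, pairingHom_apply,
    form_self_eq_zero hω, Int.cast_zero]

theorem eventually_stabilityHom_pos (hω : ∀ a b, ω a b = -ω b a) (γ : S r) :
    ∀ᶠ θ in 𝓝 (selfStability ω γ), ∀ a ≤ γ.1, 0 < pairingHom ω γ.1 a →
      0 < stabilityHom θ (slope θ γ) a := by
  refine (eventually_all_finite (Set.finite_Iic γ.1)).mpr fun a _ =>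
    eventually_imp_distrib_left.mpr fun ha => ?_
  have hcont : Continuous fun θ : Fin r → ℝ => stabilityHom θ (slope θ γ) a := by
    have := continuous_slope γ
    simp only [stabilityHom_apply]
    fun_prop
  refine (hcont.tendsto (selfStability ω γ)).eventually_const_lt ?_
  rwa [slope_selfStability hω, stabilityHom_selfStability, Int.cast_pos]

theorem commute_prod_take_prod_drop {R σ : Type*} [Monoid R] [SetLike σ R]
    (𝒜 : (Fin r → ℕ) → σ) [SetLike.GradedMonoid 𝒜]
    (hcomm : ∀ γ γ' : S r, ω (toLattice γ.1) (toLattice γ'.1) = 0 →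
      ∀ x ∈ 𝒜 γ.1, ∀ y ∈ 𝒜 γ'.1, Commute x y)
    {A : S r → R} (hA : ∀ γ, A γ ∈ 𝒜 γ.1) {α : List (S r)} {k : ℕ} (h : cutPairing ω α k = 0) :
    Commute ((α.take k).map A).prod ((α.drop k).map A).prod := by
  have hmem : ∀ β : List (S r), (β.map A).prod ∈ 𝒜 (total β) := fun β =>
    SetLike.list_prod_map_mem_graded β Subtype.val A fun a _ => hA a
  rcases eq_or_ne (α.take k) [] with htake | htake
  · rw [htake]
    exact Commute.one_left _
  rcases eq_or_ne (α.drop k) [] with hdrop | hdrop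
  · rw [hdrop]
    exact Commute.one_right _
  exact hcomm ⟨_, total_ne_zero htake⟩ ⟨_, total_ne_zero hdrop⟩ h _ (hmem _) _ (hmem _)

variable {R : Type*} [Ring R] [Algebra ℚ R]

theorem eventually_rational_eq {σ : Type*} [SetLike σ R] (𝒜 : (Fin r → ℕ) → σ)
    [SetLike.GradedMonoid 𝒜] (hω : ∀ a b, ω a b = -ω b a)
    (hcomm : ∀ γ γ' : S r, ω (toLattice γ.1) (toLattice γ'.1) = 0 →
      ∀ x ∈ 𝒜 γ.1, ∀ y ∈ 𝒜 γ'.1, Commute x y)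
    {A : S r → R} (hA : ∀ γ, A γ ∈ 𝒜 γ.1) (γ : S r) :
    ∀ᶠ θ in 𝓝 (selfStability ω γ), rational θ A γ = act (attractorCollection ω) A γ := by
  filter_upwards [eventually_stabilityHom_pos hω γ] with θ hpos
  rw [rational_eq_act_cutCollection,
    act_congr A fun α hα => attractorCollection_eq_cutCollection hω hα]
  refine act_cutCollection_eq (form_self_eq_zero hω _) (stabilityHom_eq_zero_iff.mpr rfl) hpos
    fun α hα k _ hzero => commute_prod_take_prod_drop 𝒜 hcomm hA ?_
  rwa [← pairingHom_eq_cutPairing hω hα]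

theorem attractorRational_eq_of_eventually {A : S r → R} {γ : S r} {x : R}
    (h : ∀ᶠ θ in attractorFilter ω γ, rational θ A γ = x) : attractorRational ω A γ = x := by
  have hex : ∃ x : R, ∀ᶠ θ in attractorFilter ω γ, rational θ A γ = x := ⟨x, h⟩
  have := neBot_attractorFilter ω γ
  rw [attractorRational, dif_pos hex]
  obtain ⟨θ, hchoose, hx⟩ := (hex.choose_spec.and h).exists
  exact hchoose.symm.trans hx

end Attractor

end AttractorDT

theorem mainTheorem3_general {r : ℕ} {R σ : Type*} [Ring R] [Algebra ℚ R] [SetLike σ R]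
    (𝒜 : (Fin r → ℕ) → σ) [SetLike.GradedMonoid 𝒜]
    (ω : LinearMap.BilinForm ℤ (Fin r → ℤ)) (hω : ∀ a b, ω a b = -ω b a)
    (hcomm : ∀ γ γ' : AttractorDT.S r,
      ω (AttractorDT.toLattice γ.1) (AttractorDT.toLattice γ'.1) = 0 →
        ∀ x ∈ 𝒜 γ.1, ∀ y ∈ 𝒜 γ'.1, Commute x y)
    (A : AttractorDT.S r → R) (hA : ∀ γ, A γ ∈ 𝒜 γ.1) :
    (∀ γ : AttractorDT.S r, (AttractorDT.attractorFilter ω γ).NeBot ∧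
      ∀ᶠ θ' in 𝓝 (AttractorDT.selfStability ω γ),
        AttractorDT.rational θ' A γ = AttractorDT.attractorRational ω A γ) ∧
    AttractorDT.attractorRational ω A =
      AttractorDT.act (AttractorDT.attractorCollection ω) A := by
  have hnear := AttractorDT.eventually_rational_eq 𝒜 hω hcomm hA
  have hattractor : AttractorDT.attractorRational ω A =
      AttractorDT.act (AttractorDT.attractorCollection ω) A := funext fun γ =>
    AttractorDT.attractorRational_eq_of_eventually ((hnear γ).filter_mono nhdsWithin_le_nhds)
  refine ⟨fun γ => ⟨AttractorDT.neBot_attractorFilter ω γ, ?_⟩, hattractor⟩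
  rw [hattractor]
  exact hnear γ

theorem mainTheorem3 {r : ℕ} {R : Type*} [Ring R] [Algebra ℚ R]
    (𝒜 : (Fin r → ℕ) → Submodule ℚ R) [GradedAlgebra 𝒜]
    (ω : LinearMap.BilinForm ℤ (Fin r → ℤ))
    (hω : ∀ a b, ω a b = -ω b a)
    (hcomm : ∀ γ γ' : AttractorDT.S r,
      ω (AttractorDT.toLattice γ.1) (AttractorDT.toLattice γ'.1) = 0 →
        ∀ x ∈ 𝒜 γ.1, ∀ y ∈ 𝒜 γ'.1, Commute x y)
    (A : AttractorDT.S r → R) (hA : ∀ γ, A γ ∈ 𝒜 γ.1) :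
    (∀ γ : AttractorDT.S r, (AttractorDT.attractorFilter ω γ).NeBot ∧
      ∀ᶠ θ' in AttractorDT.attractorFilter ω γ,
        AttractorDT.rational θ' A γ = AttractorDT.attractorRational ω A γ) ∧
    AttractorDT.attractorRational ω A =
      AttractorDT.act (AttractorDT.attractorCollection ω) A :=
  (mainTheorem3_general 𝒜 ω hω hcomm A hA).imp_left fun h γ =>
    ⟨(h γ).1, (h γ).2.filter_mono nhdsWithin_le_nhds⟩
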